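/- Let $\mathcal M=(Q,A,\Gamma)$ be a robust Markov decision process: $Q$ and $A$ are finite, each state $q$ has a nonempty set $A(q)\subseteq A$ of available actions, and for $q\in Q$, $a\in A(q)$ there is a nonempty set $\Gamma_{q,a}$ of probability distributions on $Q$. Let $q_u\in Q$ be an absorbing unsafe state, i.e. $\Gamma_{q_u,a}=\{\delta_{q_u}\}$ for all $a\in A(q_u)$, let $Q_{\rm safe}=Q\setminus\{q_u\}$ and let $Q_{\rm tgt}\subseteq Q_{\rm safe}$. A strategy $\sigma\in\Sigma$ maps each finite path (of alternating states and actions) to an action available at its last state, and is stationary if it depends on the last state only; an adversary $\xi\in\Xi$ maps each finite path with last state $q$ and each $a\in A(q)$ to an element of $\Gamma_{q,a}$. Let $P^{q,\sigma}_\xi$ be the resulting law of the state process $\omega$ started at $q$, let $$P_{\rm reach}(q,\sigma,\xi)=P^{q,\sigma}_\xi\big[\exists k\ge 0:\ \omega(k)\in Q_{\rm tgt}\text{ and }\omega(k')\in Q_{\rm safe}\ \forall k'<k\big],\qquad \underline p^\infty(q)=\sup_{\sigma\in\Sigma}\inf_{\xi\in\Xi}P_{\rm reach}(q,\sigma,\xi),$$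 and let $Q_{\rm reach}=\{q:\underline p^\infty(q)>0\}$. Put $$A^*(q)=\arg\max_{a\in A(q)}\ \inf_{\gamma\in\Gamma_{q,a}}\sum_{q'\in Q}\gamma(q')\,\underline p^\infty(q'),$$ $Q^0=Q_{\rm tgt}$, and for $m\ge 1$ $$Q^m=Q^{m-1}\cup\Big\{q\in Q\setminus Q^{m-1}:\ \exists a\in A^*(q),\ \inf_{\gamma\in\Gamma_{q,a}}\sum_{q'\in Q^{m-1}}\gamma(q')>0\Big\},\qquad m_{\max}=\min\{m\ge1:Q^m=Q^{m-1}\}.$$ (The infima over $\gamma$ are minima when the sets $\Gamma_{q,a}$ are closed.) Let $\widetilde{\mathcal M}$ be the robust MDP obtained from $\mathcal M$ by replacing $\Gamma_{q,a}$ by $\{\delta_{q_u}\}$ for all $q\in Q_{\rm tgt}$. A stationary strategy $\sigma$ is called proper if, in $\widetilde{\mathcal M}$, $\lim_{k\to\infty}P^{q,\sigma}_\xi[\omega(k)\in Q_{\rm reach}]=0$ for every $q\in Q$ and every adversary $\xi$ of $\widetilde{\mathcal M}$; a strategy $\sigma$ is called optimal if it attains $\max_{\sigma'\in\Sigma}\inf_{\xi\in\Xi}P_{\rm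 reach}(q,\sigma',\xi)$ for every $q\in Q$. Then $m_{\max}$ exists, $Q^{m_{\max}}=Q_{\rm reach}$, and each $q\in Q_{\rm reach}\setminus Q_{\rm tgt}$ lies in $Q^m\setminus Q^{m-1}$ for exactly one $m\in\{1,\dots,m_{\max}\}$. Consequently there is a stationary strategy $\sigma^*$ with $$\sigma^*(q)\in\Big\{a\in A^*(q):\ \inf_{\gamma\in\Gamma_{q,a}}\sum_{q'\in Q^{m-1}}\gamma(q')>0\Big\}\quad\text{for all } q\in Q^m\setminus Q^{m-1},\ m\in\{1,\dots,m_{\max}\},$$ and with arbitrary available actions at the states of $Q_{\rm tgt}\cup(Q\setminus Q_{\rm reach})$. Every such $\sigma^*$ takes at every state an action that maximizes the worst-case expectation of $\underline p^\infty$ in $\widetilde{\mathcal M}$ (equivalently, $\sigma^*(q)\in A^*(q)$ for all $q\notin Q_{\rm tgt}$), is proper, and is optimal. -/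

import Mathlib

open MeasureTheory ProbabilityTheory Filter Topology
open scoped ENNReal

noncomputable section

namespace RobustReach

/-- A (rectangular) robust Markov decision process with states `Q` and actions `A`:
`avail q` is the set of actions available at `q`, and `Γ q a` is the ambiguity set of transition
distributions for the pair `(q, a)`. -/
structure RobustMDP (Q A : Type*) where
  avail : Q → Set A
  avail_nonempty : ∀ q, (avail q).Nonempty
  Γ : Q → A → Set (PMF Q)
  Γ_nonempty : ∀ q, ∀ a ∈ avail q, (Γ q a).Nonempty

/-- Finite paths `q₀ -a₀→ q₁ -a₁→ ⋯ -aₖ₋₁→ qₖ`. -/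
inductive FinPath (Q A : Type*) where
  | start (q : Q) : FinPath Q A
  | step (ω : FinPath Q A) (a : A) (q : Q) : FinPath Q A

/-- The last state of a finite path. -/
def FinPath.last {Q A : Type*} : FinPath Q A → Q
  | .start q => q
  | .step _ _ q => q

namespace RobustMDP

variable {Q A : Type*}

/-- A (history-dependent) strategy. It is defined on all finite alternating sequences; its values
on sequences that are not paths of the robust MDP do not influence the induced process. -/
structure Strategy (M : RobustMDP Q A) where
  act : FinPath Q A → A
  act_mem : ∀ ω, act ω ∈ M.avail ω.last

/-- A stationary strategy: the action depends on the current state only. -/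
structure StationaryStrategy (M : RobustMDP Q A) where
  act : Q → A
  act_mem : ∀ q, act q ∈ M.avail q

/-- A stationary strategy viewed as a strategy. -/
def StationaryStrategy.toStrategy {M : RobustMDP Q A} (σ : M.StationaryStrategy) :
    M.Strategy where
  act ω := σ.act ω.last
  act_mem ω := σ.act_mem ω.last

/-- A (history-dependent) adversary: it resolves the ambiguity after every finite path and
every available action. -/
structure Adversary (M : RobustMDP Q A) where
  dist : FinPath Q A → A → PMF Q
  dist_mem : ∀ ω, ∀ a ∈ M.avail ω.last, dist ω a ∈ M.Γ ω.last a

/-- The finite path generated by the strategy `σ` along the states `x 0, …, x n`. -/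
def Strategy.history {M : RobustMDP Q A} (σ : M.Strategy) :
    (n : ℕ) → (Finset.Iic n → Q) → FinPath Q A
  | 0, x => .start (x ⟨0, Finset.mem_Iic.2 le_rfl⟩)
  | n + 1, x =>
    let ω := σ.history n
      (fun i => x ⟨i.1, Finset.mem_Iic.2 ((Finset.mem_Iic.1 i.2).trans n.le_succ)⟩)
    .step ω (σ.act ω) (x ⟨n + 1, Finset.mem_Iic.2 le_rfl⟩)

open Classical in
/-- The auxiliary robust MDP in which all target states move to `qu` with probability one. -/
def redirect (M : RobustMDP Q A) (tgt : Set Q) (qu : Q) : RobustMDP Q A where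
  avail := M.avail
  avail_nonempty := M.avail_nonempty
  Γ q a := if q ∈ tgt then {PMF.pure qu} else M.Γ q a
  Γ_nonempty q a ha := by
    by_cases h : q ∈ tgt
    · simp [h]
    · simpa [h] using M.Γ_nonempty q a ha

/-- The same stationary strategy in the auxiliary robust MDP. -/
def StationaryStrategy.redirect {M : RobustMDP Q A} (σ : M.StationaryStrategy) (tgt : Set Q)
    (qu : Q) : (M.redirect tgt qu).StationaryStrategy where
  act := σ.act
  act_mem := σ.act_mem

section PathLaw

variable [Fintype Q] [MeasurableSpace Q] [DiscreteMeasurableSpace Q]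

/-- The conditional law of the state at time `n + 1` given the states at times `0, …, n`. -/
def stepKernel (M : RobustMDP Q A) (σ : M.Strategy) (ξ : M.Adversary) (n : ℕ) :
    Kernel (Finset.Iic n → Q) Q where
  toFun x := (ξ.dist (σ.history n x) (σ.act (σ.history n x))).toMeasure
  measurable' := measurable_of_finite _

instance (M : RobustMDP Q A) (σ : M.Strategy) (ξ : M.Adversary) (n : ℕ) :
    IsMarkovKernel (M.stepKernel σ ξ n) where
  isProbabilityMeasure x :=
    PMF.toMeasure.isProbabilityMeasure (ξ.dist (σ.history n x) (σ.act (σ.history n x)))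

/-- The law, on state sequences, of the process started at `q` under the strategy `σ` and the
adversary `ξ` (Ionescu-Tulcea). -/
def pathMeasure (M : RobustMDP Q A) (σ : M.Strategy) (ξ : M.Adversary) (q : Q) :
    Measure (ℕ → Q) :=
  Kernel.traj (X := fun _ => Q) (M.stepKernel σ ξ) 0 (fun _ => q)

/-- Unbounded-horizon reach-avoid probability: `tgt` is reached at some time, and the process
stays in `safe` before that time. -/
def reachProb (M : RobustMDP Q A) (safe tgt : Set Q) (σ : M.Strategy) (ξ : M.Adversary)
    (q : Q) : ℝ≥0∞ :=
  M.pathMeasure σ ξ q {ω | ∃ k, ω k ∈ tgt ∧ ∀ k' < k, ω k' ∈ safe}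

/-- Worst-case reach-avoid probability of a strategy. -/
def worstReachProb (M : RobustMDP Q A) (safe tgt : Set Q) (σ : M.Strategy) (q : Q) : ℝ≥0∞ :=
  ⨅ ξ : M.Adversary, M.reachProb safe tgt σ ξ q

/-- Optimal worst-case reach-avoid probability, over all history-dependent strategies. -/
def optReachProb (M : RobustMDP Q A) (safe tgt : Set Q) (q : Q) : ℝ≥0∞ :=
  ⨆ σ : M.Strategy, M.worstReachProb safe tgt σ q

/-- The states with positive optimal worst-case reach-avoid probability. -/
def reachSet (M : RobustMDP Q A) (safe tgt : Set Q) : Set Q :=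
  {q | 0 < M.optReachProb safe tgt q}

/-- A strategy is optimal if, from every state, it maximizes the worst-case reach-avoid
probability among all history-dependent strategies. -/
def IsOptimal (M : RobustMDP Q A) (safe tgt : Set Q) (σ : M.Strategy) : Prop :=
  ∀ q, ∀ σ' : M.Strategy, M.worstReachProb safe tgt σ' q ≤ M.worstReachProb safe tgt σ q

end PathLaw

section Bellman

variable [Fintype Q]

/-- Worst-case expectation of `V` after action `a` in state `q`. -/
def worstExp (M : RobustMDP Q A) (V : Q → ℝ≥0∞) (q : Q) (a : A) : ℝ≥0∞ :=
  ⨅ γ ∈ M.Γ q a, ∑ q', γ q' * V q'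

/-- Worst-case probability of moving into `S` after action `a` in state `q`. -/
def worstMass (M : RobustMDP Q A) (S : Set Q) (q : Q) (a : A) : ℝ≥0∞ :=
  ⨅ γ ∈ M.Γ q a, ∑ q', S.indicator (fun r => γ r) q'

/-- The available actions that maximize the worst-case expectation of `V`. -/
def argmaxActions (M : RobustMDP Q A) (V : Q → ℝ≥0∞) (q : Q) : Set A :=
  {a | a ∈ M.avail q ∧ ∀ b ∈ M.avail q, M.worstExp V q b ≤ M.worstExp V q a}

end Bellman

section Construction

variable [Fintype Q] [MeasurableSpace Q] [DiscreteMeasurableSpace Q]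

/-- The optimal actions `A*(q)`. -/
def optActions (M : RobustMDP Q A) (safe tgt : Set Q) (q : Q) : Set A :=
  M.argmaxActions (M.optReachProb safe tgt) q

/-- The actions of `A*(q)` whose worst-case probability of moving into `S` is positive. -/
def progressActions (M : RobustMDP Q A) (safe tgt S : Set Q) (q : Q) : Set A :=
  {a | a ∈ M.optActions safe tgt q ∧ 0 < M.worstMass S q a}

/-- The nested backward-reachable sets `Q^m`. -/
def nested (M : RobustMDP Q A) (safe tgt : Set Q) : ℕ → Set Q
  | 0 => tgt
  | m + 1 => M.nested safe tgt m ∪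
      {q | q ∉ M.nested safe tgt m ∧
        (M.progressActions safe tgt (M.nested safe tgt m) q).Nonempty}

/-- The first `m ≥ 1` with `Q^m = Q^{m-1}`. -/
def mMax (M : RobustMDP Q A) (safe tgt : Set Q) : ℕ :=
  sInf {m | 1 ≤ m ∧ M.nested safe tgt m = M.nested safe tgt (m - 1)}

/-- The stationary strategies produced by the construction: at `q ∈ Q^m \ Q^{m-1}` an optimal
action with positive worst-case probability of moving into `Q^{m-1}` is taken; the action is
arbitrary at all the other states. -/
def IsBackwardStrategy (M : RobustMDP Q A) (safe tgt : Set Q) (σ : M.StationaryStrategy) :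
    Prop :=
  ∀ m, 1 ≤ m → m ≤ M.mMax safe tgt →
    ∀ q ∈ M.nested safe tgt m \ M.nested safe tgt (m - 1),
      σ.act q ∈ M.progressActions safe tgt (M.nested safe tgt (m - 1)) q

/-- Properness: in the auxiliary robust MDP, for every initial state and every adversary, the
probability of being in the set of states of positive value at time `k` tends to `0`. -/
def IsProper (M : RobustMDP Q A) (tgt : Set Q) (qu : Q) (σ : M.StationaryStrategy) : Prop :=
  ∀ q, ∀ ξ : (M.redirect tgt qu).Adversary,
    Tendsto (fun k : ℕ => (M.redirect tgt qu).pathMeasure (σ.redirect tgt qu).toStrategy ξ q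
      {ω | ω k ∈ M.reachSet {qu}ᶜ tgt}) atTop (𝓝 0)

end Construction

end RobustMDP

end RobustReach

end

namespace RobustReach

namespace RobustMDP

variable {Q A : Type*}

/-! Let `U` be the least fixed point of the robust Bellman operator. An adversary that is nearly
worst in every step, with summable errors, makes the stopped process of `U` almost a
supermartingale, so no strategy beats `U` (`optReachProb_le_bellmanValue`).

Conversely, let a stationary strategy use `U`-maximizing actions that also enter the previous layer
with positive worst-case probability. Then the stopped process of `U` is a submartingale, so `U` is
at most the reach probability plus the probability of still being undecided at a state of positive
value. The latter tends to zero: a function decaying geometrically in the layer index grows in mean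
by a fixed amount at such states (`exists_drift`), so only finitely many visits are expected
(`tendsto_measure_avoids_mem`). The same drift gives properness.

The layers exhaust `{U > 0}` because `U` is least: were they to stop earlier, lowering the top
values outside them would give a smaller supersolution (`bellmanValue_eq_zero_of_closed`). The
layers are built for a general `V`, since the equality of `U` with the optimal probability is itself
proved through the layers of `U`. -/

/-- The history along an infinite state sequence up to time `n`. -/
def Strategy.hist {M : RobustMDP Q A} (σ : M.Strategy) (n : ℕ) (ω : ℕ → Q) : FinPath Q A :=
  σ.history n (fun i => ω i)

lemma Strategy.last_hist {M : RobustMDP Q A} (σ : M.Strategy) (n : ℕ) (ω : ℕ → Q) :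
    (σ.hist n ω).last = ω n := by
  cases n <;> rfl

/-- The distribution of the state at time `n + 1` along the state sequence `ω`. -/
noncomputable def nextDist (M : RobustMDP Q A) (σ : M.Strategy) (ξ : M.Adversary) (n : ℕ)
    (ω : ℕ → Q) : PMF Q :=
  ξ.dist (σ.hist n ω) (σ.act (σ.hist n ω))

lemma nextDist_mem (M : RobustMDP Q A) (σ : M.Strategy) (ξ : M.Adversary) (n : ℕ) (ω : ℕ → Q) :
    M.nextDist σ ξ n ω ∈ M.Γ (ω n) (σ.act (σ.hist n ω)) := by
  have h := ξ.dist_mem (σ.hist n ω) _ (σ.act_mem _)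
  rwa [σ.last_hist] at h

lemma nextDist_toStrategy_mem (M : RobustMDP Q A) (σ : M.StationaryStrategy) (ξ : M.Adversary)
    (n : ℕ) (ω : ℕ → Q) : M.nextDist σ.toStrategy ξ n ω ∈ M.Γ (ω n) (σ.act (ω n)) := by
  have h := M.nextDist_mem σ.toStrategy ξ n ω
  rwa [show σ.toStrategy.act (σ.toStrategy.hist n ω) = σ.act (ω n) from
    congrArg σ.act (Strategy.last_hist _ n ω)] at h

/-- Reduces functions of the first `n + 1` states to functions on a finite type, where measurability
is automatic. -/
lemma exists_eq_comp_frestrictLe {β : Type*} [Nonempty β] {n : ℕ} {f : (ℕ → Q) → β}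
    (hf : DependsOn f (Set.Iic n)) :
    ∃ g : (Finset.Iic n → Q) → β, ∀ ω, f ω = g (Preorder.frestrictLe n ω) := by
  have h : Function.FactorsThrough f (Preorder.frestrictLe (π := fun _ : ℕ => Q) n) := by
    intro x y hxy
    refine hf fun i hi => ?_
    exact congrFun hxy ⟨i, Finset.mem_Iic.2 hi⟩
  obtain ⟨g, hg⟩ := (Function.factorsThrough_iff f).1 h
  exact ⟨g, fun ω => congrFun hg ω⟩

lemma sum_pmf_mul_const [Fintype Q] (p : PMF Q) (c : ℝ≥0∞) : ∑ r, p r * c = c := by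
  have h := p.tsum_coe
  rw [tsum_fintype] at h
  rw [← Finset.sum_mul, h, one_mul]

/-! ### One-step disintegration of the path law -/

section PathLaw

variable [Fintype Q] [MeasurableSpace Q] [DiscreteMeasurableSpace Q]

instance (M : RobustMDP Q A) (σ : M.Strategy) (ξ : M.Adversary) (q : Q) :
    IsProbabilityMeasure (M.pathMeasure σ ξ q) := by
  unfold pathMeasure; infer_instance

lemma measurableSet_of_dependsOn_Iic {n : ℕ} {p : (ℕ → Q) → Prop}
    (hp : DependsOn p (Set.Iic n)) : MeasurableSet {ω | p ω} := by
  obtain ⟨g, hg⟩ := exists_eq_comp_frestrictLe hp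
  rw [show {ω | p ω} = Preorder.frestrictLe n ⁻¹' {x | g x} from Set.ext fun ω => by simp [hg]]
  exact Preorder.measurable_frestrictLe n (Set.toFinite _).measurableSet

/-- The law of the next state given the past. -/
lemma lintegral_pathMeasure_succ (M : RobustMDP Q A) (σ : M.Strategy) (ξ : M.Adversary) (q : Q)
    (n : ℕ) {G : (ℕ → Q) → Q → ℝ≥0∞} (hG : DependsOn G (Set.Iic n)) :
    ∫⁻ ω, G ω (ω (n + 1)) ∂M.pathMeasure σ ξ q =
      ∫⁻ ω, ∑ r, M.nextDist σ ξ n ω r * G ω r ∂M.pathMeasure σ ξ q := by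
  obtain ⟨g, hg⟩ := exists_eq_comp_frestrictLe hG
  -- The joint law of the past up to `n` and the next state is the past law composed with the step
  -- kernel.
  have hmap := Kernel.partialTraj_compProd_eq_map_traj (X := fun _ => Q)
    (κ := M.stepKernel σ ξ) (Nat.zero_le n) (x₀ := fun _ => q)
  have hgm : Measurable (Function.uncurry g) := measurable_of_finite _
  have hleft : ∫⁻ ω, G ω (ω (n + 1)) ∂M.pathMeasure σ ξ q =
      ∫⁻ y, Function.uncurry g y ∂(M.pathMeasure σ ξ q).map
        (fun x => (Preorder.frestrictLe n x, x (n + 1))) := by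
    rw [lintegral_map hgm (by fun_prop)]
    simp [hg]
  rw [hleft, pathMeasure, ← hmap, Measure.lintegral_compProd hgm,
    ← Kernel.traj_map_frestrictLe_apply, lintegral_map (measurable_of_finite _) (by fun_prop)]
  refine lintegral_congr fun ω => ?_
  rw [lintegral_fintype]
  refine Finset.sum_congr rfl fun r _ => ?_
  rw [mul_comm, hg]
  congr 1
  exact PMF.toMeasure_apply_singleton _ _ (measurableSet_singleton r)

lemma lintegral_pathMeasure_zero (M : RobustMDP Q A) (σ : M.Strategy) (ξ : M.Adversary) (q : Q)
    (f : Q → ℝ≥0∞) : ∫⁻ ω, f (ω 0) ∂M.pathMeasure σ ξ q = f q := by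
  have hm : Measurable fun x : Finset.Iic 0 → Q => f (x ⟨0, Finset.mem_Iic.2 le_rfl⟩) :=
    measurable_of_finite _
  have h := lintegral_map (μ := M.pathMeasure σ ξ q) hm (Preorder.measurable_frestrictLe 0)
  rw [pathMeasure, Kernel.traj_map_frestrictLe_apply, Kernel.partialTraj_self,
    Kernel.id_apply, lintegral_dirac' _ hm] at h
  exact h.symm

end PathLaw

/-! ### The stopped value process -/

/-- The sequence `ω` avoids `T` up to and including time `n`. -/
def Avoids (T : Set Q) (n : ℕ) (ω : ℕ → Q) : Prop := ∀ i ≤ n, ω i ∉ T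

/-- The reach-avoid specification is met at or before time `n`. -/
def ReachedBy (safe tgt : Set Q) (n : ℕ) (ω : ℕ → Q) : Prop :=
  ∃ k ≤ n, ω k ∈ tgt ∧ ∀ k' < k, ω k' ∈ safe

lemma dependsOn_avoids (T : Set Q) (n : ℕ) : DependsOn (Avoids T n) (Set.Iic n) := by
  intro x y h
  refine propext (forall₂_congr fun i hi => ?_)
  rw [h i hi]

lemma dependsOn_reachedBy (safe tgt : Set Q) (n : ℕ) :
    DependsOn (ReachedBy safe tgt n) (Set.Iic n) := by
  intro x y h
  refine propext (exists_congr fun k => and_congr_right fun hk => ?_)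
  rw [h k hk]
  refine and_congr_right fun _ => forall₂_congr fun i hi => ?_
  rw [h i (hi.le.trans hk)]

lemma avoids_succ_iff {T : Set Q} {n : ℕ} {ω : ℕ → Q} :
    Avoids T (n + 1) ω ↔ Avoids T n ω ∧ ω (n + 1) ∉ T := by
  refine ⟨fun h => ⟨fun i hi => h i (by omega), h _ le_rfl⟩, fun h i hi => ?_⟩
  rcases Nat.le_succ_iff.1 hi with hi | rfl
  · exact h.1 i hi
  · exact h.2

/-- A first success at time `n + 1` requires the path to be still undecided at time `n`; avoiding
`tgt ∪ safeᶜ` is what "undecided" means. -/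
lemma reachedBy_succ_iff {safe tgt : Set Q} {n : ℕ} {ω : ℕ → Q} :
    ReachedBy safe tgt (n + 1) ω ↔
      ReachedBy safe tgt n ω ∨ (Avoids (tgt ∪ safeᶜ) n ω ∧ ω (n + 1) ∈ tgt) := by
  constructor
  · rintro ⟨k, hk, hkt, hks⟩
    by_cases hr : ReachedBy safe tgt n ω
    · exact Or.inl hr
    rcases Nat.le_succ_iff.1 hk with hk | rfl
    · exact absurd ⟨k, hk, hkt, hks⟩ hr
    · refine Or.inr ⟨fun i hi => ?_, hkt⟩
      rintro (hit | his)
      · exact hr ⟨i, hi, hit, fun j hj => hks j (by omega)⟩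
      · exact his (hks i (by omega))
  · rintro (⟨k, hk, h⟩ | ⟨ha, ht⟩)
    · exact ⟨k, by omega, h⟩
    · refine ⟨n + 1, le_rfl, ht, fun i hi => ?_⟩
      by_contra his
      exact ha i (by omega) (Or.inr his)

open Classical in
/-- The value `1` after success, `w` while undecided, and `0` after
failure. -/
noncomputable def stoppedValue (safe tgt : Set Q) (n : ℕ) (ω : ℕ → Q) (w : ℝ≥0∞) : ℝ≥0∞ :=
  if ReachedBy safe tgt n ω then 1 else if Avoids (tgt ∪ safeᶜ) n ω then w else 0

lemma stoppedValue_zero {safe tgt : Set Q} {W : Q → ℝ≥0∞} (h1 : ∀ q ∈ tgt, W q = 1)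
    (h0 : ∀ q ∉ safe, W q = 0) (ω : ℕ → Q) : stoppedValue safe tgt 0 ω (W (ω 0)) = W (ω 0) := by
  have hr : ReachedBy safe tgt 0 ω ↔ ω 0 ∈ tgt := by simp [ReachedBy]
  have ha : Avoids (tgt ∪ safeᶜ) 0 ω ↔ ω 0 ∉ tgt ∧ ω 0 ∈ safe := by simp [Avoids]
  unfold stoppedValue
  rw [hr, ha]
  split_ifs with h h'
  · exact (h1 _ h).symm
  · rfl
  · exact (h0 _ fun hs => h' ⟨h, hs⟩).symm

/-- The boundary values of `W` already encode a decision made at time `n + 1`, so the case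
distinction may be made at time `n`, where it is determined by the past. -/
lemma stoppedValue_succ {safe tgt : Set Q} {W : Q → ℝ≥0∞} (h1 : ∀ q ∈ tgt, W q = 1)
    (h0 : ∀ q ∉ safe, W q = 0) (n : ℕ) (ω : ℕ → Q) :
    stoppedValue safe tgt (n + 1) ω (W (ω (n + 1))) =
      stoppedValue safe tgt n ω (W (ω (n + 1))) := by
  classical
  unfold stoppedValue
  simp only [reachedBy_succ_iff, avoids_succ_iff]
  by_cases hr : ReachedBy safe tgt n ω
  · simp [hr]
  by_cases ha : Avoids (tgt ∪ safeᶜ) n ω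
  · by_cases ht : ω (n + 1) ∈ tgt
    · simp [hr, ha, ht, h1]
    · by_cases hs : ω (n + 1) ∈ safe
      · simp [hr, ha, ht, hs]
      · simp [hr, ha, ht, hs, h0]
  · simp [hr, ha]

lemma dependsOn_stoppedValue (safe tgt : Set Q) (W : Q → ℝ≥0∞) (n : ℕ) :
    DependsOn (fun ω r => stoppedValue safe tgt n ω (W r)) (Set.Iic n) := by
  intro x y h
  classical
  funext r
  simp only [stoppedValue, dependsOn_reachedBy safe tgt n h, dependsOn_avoids (tgt ∪ safeᶜ) n h]

lemma sum_mul_stoppedValue [Fintype Q] (safe tgt : Set Q) (W : Q → ℝ≥0∞) (n : ℕ) (ω : ℕ → Q)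
    (p : PMF Q) :
    ∑ r, p r * stoppedValue safe tgt n ω (W r) =
      stoppedValue safe tgt n ω (∑ r, p r * W r) := by
  unfold stoppedValue
  split_ifs
  · exact sum_pmf_mul_const p 1
  · rfl
  · exact sum_pmf_mul_const p 0

section PathLaw

variable [Fintype Q] [MeasurableSpace Q] [DiscreteMeasurableSpace Q]

lemma lintegral_stoppedValue_zero (M : RobustMDP Q A) {safe tgt : Set Q} {W : Q → ℝ≥0∞}
    (h1 : ∀ q ∈ tgt, W q = 1) (h0 : ∀ q ∉ safe, W q = 0) (σ : M.Strategy) (ξ : M.Adversary)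
    (q : Q) : ∫⁻ ω, stoppedValue safe tgt 0 ω (W (ω 0)) ∂M.pathMeasure σ ξ q = W q := by
  simp_rw [stoppedValue_zero h1 h0]
  exact M.lintegral_pathMeasure_zero σ ξ q W

lemma lintegral_stoppedValue_succ (M : RobustMDP Q A) {safe tgt : Set Q} {W : Q → ℝ≥0∞}
    (h1 : ∀ q ∈ tgt, W q = 1) (h0 : ∀ q ∉ safe, W q = 0) (σ : M.Strategy) (ξ : M.Adversary)
    (q : Q) (n : ℕ) :
    ∫⁻ ω, stoppedValue safe tgt (n + 1) ω (W (ω (n + 1))) ∂M.pathMeasure σ ξ q =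
      ∫⁻ ω, stoppedValue safe tgt n ω (∑ r, M.nextDist σ ξ n ω r * W r)
        ∂M.pathMeasure σ ξ q := by
  simp_rw [stoppedValue_succ h1 h0]
  rw [M.lintegral_pathMeasure_succ σ ξ q n (dependsOn_stoppedValue safe tgt W n)]
  simp_rw [sum_mul_stoppedValue]

/-- If `W` does not decrease in expectation, it is a lower bound for the expected value. -/
lemma le_lintegral_stoppedValue (M : RobustMDP Q A) {safe tgt : Set Q} {W : Q → ℝ≥0∞}
    (h1 : ∀ q ∈ tgt, W q = 1) (h0 : ∀ q ∉ safe, W q = 0) (σ : M.Strategy) (ξ : M.Adversary)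
    (h : ∀ n ω, ω n ∉ tgt → W (ω n) ≤ ∑ r, M.nextDist σ ξ n ω r * W r) (q : Q) (n : ℕ) :
    W q ≤ ∫⁻ ω, stoppedValue safe tgt n ω (W (ω n)) ∂M.pathMeasure σ ξ q := by
  induction n with
  | zero => rw [lintegral_stoppedValue_zero M h1 h0]
  | succ n ih =>
    rw [lintegral_stoppedValue_succ M h1 h0]
    refine ih.trans (lintegral_mono fun ω => ?_)
    unfold stoppedValue
    split_ifs with hr ha
    · exact le_rfl
    · exact h n ω fun ht => ha n le_rfl (Or.inl ht)
    · exact le_rfl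

/-- If `W` increases in expectation by at most `ε n` in step `n`, it is up to these errors an upper
bound for the expected value. -/
lemma lintegral_stoppedValue_le (M : RobustMDP Q A) {safe tgt : Set Q} {W : Q → ℝ≥0∞}
    (h1 : ∀ q ∈ tgt, W q = 1) (h0 : ∀ q ∉ safe, W q = 0) (σ : M.Strategy) (ξ : M.Adversary)
    (ε : ℕ → ℝ≥0∞)
    (h : ∀ n ω, ω n ∉ tgt → ω n ∈ safe → ∑ r, M.nextDist σ ξ n ω r * W r ≤ W (ω n) + ε n)
    (q : Q) (n : ℕ) :
    ∫⁻ ω, stoppedValue safe tgt n ω (W (ω n)) ∂M.pathMeasure σ ξ q ≤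
      W q + ∑ i ∈ Finset.range n, ε i := by
  induction n with
  | zero => rw [lintegral_stoppedValue_zero M h1 h0]; simp
  | succ n ih =>
    rw [lintegral_stoppedValue_succ M h1 h0, Finset.sum_range_succ, ← add_assoc]
    calc _ ≤ ∫⁻ ω, (stoppedValue safe tgt n ω (W (ω n)) + ε n) ∂M.pathMeasure σ ξ q := by
          refine lintegral_mono fun ω => ?_
          unfold stoppedValue
          split_ifs with hr ha
          · exact le_self_add
          · exact h n ω (fun ht => ha n le_rfl (Or.inl ht))
              (by_contra fun hs => ha n le_rfl (Or.inr hs))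
          · exact zero_le
      _ = ∫⁻ ω, stoppedValue safe tgt n ω (W (ω n)) ∂M.pathMeasure σ ξ q + ε n := by
          rw [lintegral_add_right _ measurable_const, lintegral_const, measure_univ, mul_one]
      _ ≤ _ := by gcongr

lemma measure_reachedBy_le_reachProb (M : RobustMDP Q A) (safe tgt : Set Q) (σ : M.Strategy)
    (ξ : M.Adversary) (q : Q) (n : ℕ) :
    M.pathMeasure σ ξ q {ω | ReachedBy safe tgt n ω} ≤ M.reachProb safe tgt σ ξ q :=
  measure_mono fun _ ⟨k, _, h⟩ => ⟨k, h⟩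

lemma reachProb_eq_iSup (M : RobustMDP Q A) (safe tgt : Set Q) (σ : M.Strategy)
    (ξ : M.Adversary) (q : Q) :
    M.reachProb safe tgt σ ξ q = ⨆ n, M.pathMeasure σ ξ q {ω | ReachedBy safe tgt n ω} := by
  have hmono : Monotone fun n => {ω : ℕ → Q | ReachedBy safe tgt n ω} :=
    fun m n hmn ω ⟨k, hk, h⟩ => ⟨k, hk.trans hmn, h⟩
  rw [← hmono.measure_iUnion, reachProb]
  congr 1
  ext ω
  simp only [Set.mem_ofPred_eq, Set.mem_iUnion, ReachedBy]
  exact ⟨fun ⟨k, h⟩ => ⟨k, k, le_rfl, h⟩, fun ⟨_, k, _, h⟩ => ⟨k, h⟩⟩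

/-- Whatever `W` is, the stopped value dominates the indicator of success by time `n`. -/
lemma reachProb_le_of_stoppedValue_le (M : RobustMDP Q A) {safe tgt : Set Q} {W : Q → ℝ≥0∞}
    (σ : M.Strategy) (ξ : M.Adversary) (q : Q) {c : ℝ≥0∞}
    (h : ∀ n, ∫⁻ ω, stoppedValue safe tgt n ω (W (ω n)) ∂M.pathMeasure σ ξ q ≤ c) :
    M.reachProb safe tgt σ ξ q ≤ c := by
  rw [reachProb_eq_iSup]
  refine iSup_le fun n => le_trans ?_ (h n)
  rw [← lintegral_indicator_one (measurableSet_of_dependsOn_Iic (dependsOn_reachedBy safe tgt n))]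
  refine lintegral_mono fun ω => ?_
  by_cases hr : ReachedBy safe tgt n ω <;> simp [stoppedValue, hr]

/-! ### Drift criterion -/

open Classical in
/-- If a bounded function of the state grows in expectation by `c` whenever the state is in `R`,
as long as `T` is avoided, then the process eventually leaves `R` for good or meets `T`. -/
lemma tendsto_measure_avoids_mem (M : RobustMDP Q A) (σ : M.Strategy) (ξ : M.Adversary)
    (q : Q) (T R : Set Q) {d : Q → ℝ≥0∞} {b c : ℝ≥0∞} (hb : b ≠ ∞) (hc : c ≠ 0)
    (hdb : ∀ q, d q ≤ b)
    (h : ∀ n ω, ω n ∉ T →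
      d (ω n) + R.indicator (fun _ => c) (ω n) ≤ ∑ r, M.nextDist σ ξ n ω r * d r) :
    Tendsto (fun n => M.pathMeasure σ ξ q {ω | Avoids T n ω ∧ ω n ∈ R}) atTop (𝓝 0) := by
  set P := M.pathMeasure σ ξ q
  let E : ℕ → Set (ℕ → Q) := fun n => {ω | Avoids T n ω ∧ ω n ∈ R}
  have hE : ∀ n, MeasurableSet (E n) := fun n => measurableSet_of_dependsOn_Iic (n := n) <| by
    intro x y hxy
    simp only [dependsOn_avoids T n hxy, hxy n (Set.mem_Iic.2 le_rfl)]
  -- Once `T` is met, `d` is frozen at its upper bound `b`, so meeting `T` never lowers `K`.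
  let K : ℕ → ℝ≥0∞ := fun n => ∫⁻ ω, (if Avoids T n ω then d (ω n) else b) ∂P
  have hK : ∀ n, K n + c * P (E n) ≤ K (n + 1) := by
    intro n
    have hdep : DependsOn (fun ω r => if Avoids T n ω then d r else b) (Set.Iic n) := by
      intro x y hxy
      simp only [dependsOn_avoids T n hxy]
    calc K n + c * P (E n)
        = ∫⁻ ω, ((if Avoids T n ω then d (ω n) else b) + (E n).indicator (fun _ => c) ω) ∂P := by
          rw [lintegral_add_right _ (measurable_const.indicator (hE n)),
            lintegral_indicator_const (hE n)]
      _ ≤ ∫⁻ ω, ∑ r, M.nextDist σ ξ n ω r * (if Avoids T n ω then d r else b) ∂P := by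
          refine lintegral_mono fun ω => ?_
          by_cases ha : Avoids T n ω
          · refine le_trans (le_of_eq ?_) ((h n ω (ha n le_rfl)).trans (le_of_eq ?_))
            · by_cases hR : ω n ∈ R <;> simp [ha, hR, E]
            · simp [ha]
          · simp [ha, E, sum_pmf_mul_const]
      _ = ∫⁻ ω, (if Avoids T n ω then d (ω (n + 1)) else b) ∂P :=
          (M.lintegral_pathMeasure_succ σ ξ q n hdep).symm
      _ ≤ K (n + 1) := by
          refine lintegral_mono fun ω => ?_
          simp only [avoids_succ_iff]
          by_cases ha : Avoids T n ω
          · by_cases hT : ω (n + 1) ∈ T <;> simp [ha, hT, hdb]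
          · simp [ha]
  have hsum : ∀ n, ∑ i ∈ Finset.range n, c * P (E i) ≤ K n := by
    intro n
    induction n with
    | zero => simp
    | succ n ih =>
      rw [Finset.sum_range_succ]
      exact (add_le_add_left ih _).trans (hK n)
  have hKb : ∀ n, K n ≤ b := fun n => by
    calc K n ≤ ∫⁻ _, b ∂P := lintegral_mono fun ω => by
          by_cases ha : Avoids T n ω <;> simp [ha, hdb]
      _ = b := by simp
  -- Telescoping bounds `c` times the expected number of visits by `b`; summable probabilities tend
  -- to zero.
  have htsum : ∑' n, c * P (E n) ≠ ∞ := by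
    refine ne_top_of_le_ne_top hb ?_
    rw [ENNReal.tsum_eq_iSup_nat]
    exact iSup_le fun n => (hsum n).trans (hKb n)
  rw [ENNReal.tsum_mul_left] at htsum
  have hne : ∑' n, P (E n) ≠ ∞ := fun htop => htsum (by rw [htop, ENNReal.mul_top hc])
  exact ENNReal.tendsto_atTop_zero_of_tsum_ne_top hne

end PathLaw

/-- Number of transitions of a finite path. -/
def _root_.RobustReach.FinPath.length : FinPath Q A → ℕ
  | .start _ => 0
  | .step ω _ _ => ω.length + 1

lemma Strategy.length_hist {M : RobustMDP Q A} (σ : M.Strategy) (n : ℕ) (ω : ℕ → Q) :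
    (σ.hist n ω).length = n := by
  induction n with
  | zero => rfl
  | succ n ih => exact congrArg (· + 1) ih

/-! ### The least fixed point of the Bellman operator -/

section Bellman

variable [Fintype Q]

lemma worstExp_mono (M : RobustMDP Q A) {V W : Q → ℝ≥0∞} (h : V ≤ W) (q : Q) (a : A) :
    M.worstExp V q a ≤ M.worstExp W q a :=
  iInf₂_mono fun _ _ => Finset.sum_le_sum fun r _ => mul_le_mul_right (h r) _

lemma worstExp_le_one (M : RobustMDP Q A) {V : Q → ℝ≥0∞} (h : ∀ q, V q ≤ 1) {q : Q} {a : A}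
    (ha : a ∈ M.avail q) : M.worstExp V q a ≤ 1 := by
  obtain ⟨γ, hγ⟩ := M.Γ_nonempty q a ha
  refine (iInf₂_le γ hγ).trans ?_
  refine (Finset.sum_le_sum fun r _ => mul_le_mul_right (h r) _).trans_eq ?_
  exact sum_pmf_mul_const γ 1

open Classical in
/-- The robust Bellman operator of the reach-avoid problem. -/
noncomputable def bellman (M : RobustMDP Q A) (safe tgt : Set Q) :
    (Q → ℝ≥0∞) →o (Q → ℝ≥0∞) where
  toFun V q := if q ∈ tgt then 1 else if q ∈ safe then ⨆ a ∈ M.avail q, M.worstExp V q a else 0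
  monotone' V W h q := by
    dsimp only
    split_ifs
    · exact le_rfl
    · exact iSup₂_mono fun a _ => M.worstExp_mono h q a
    · exact le_rfl

open Classical in
lemma bellman_apply (M : RobustMDP Q A) (safe tgt : Set Q) (V : Q → ℝ≥0∞) (q : Q) :
    M.bellman safe tgt V q =
      if q ∈ tgt then 1 else if q ∈ safe then ⨆ a ∈ M.avail q, M.worstExp V q a else 0 := rfl

/-- The least fixed point of the robust Bellman operator. -/
noncomputable def bellmanValue (M : RobustMDP Q A) (safe tgt : Set Q) : Q → ℝ≥0∞ :=
  (M.bellman safe tgt).lfp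

lemma bellman_bellmanValue (M : RobustMDP Q A) (safe tgt : Set Q) :
    M.bellman safe tgt (M.bellmanValue safe tgt) = M.bellmanValue safe tgt :=
  (M.bellman safe tgt).map_lfp

lemma bellmanValue_of_mem_tgt (M : RobustMDP Q A) {safe tgt : Set Q} {q : Q} (h : q ∈ tgt) :
    M.bellmanValue safe tgt q = 1 := by
  rw [← bellman_bellmanValue]
  simp [bellman_apply, h]

lemma bellmanValue_of_notMem_safe (M : RobustMDP Q A) {safe tgt : Set Q} (hts : tgt ⊆ safe)
    {q : Q} (h : q ∉ safe) : M.bellmanValue safe tgt q = 0 := by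
  rw [← bellman_bellmanValue]
  have ht : q ∉ tgt := fun ht => h (hts ht)
  simp [bellman_apply, h, ht]

lemma bellmanValue_eq_iSup (M : RobustMDP Q A) {safe tgt : Set Q} {q : Q} (ht : q ∉ tgt)
    (hs : q ∈ safe) : M.bellmanValue safe tgt q =
      ⨆ a ∈ M.avail q, M.worstExp (M.bellmanValue safe tgt) q a := by
  conv_lhs => rw [← bellman_bellmanValue]
  simp [bellman_apply, ht, hs]

lemma worstExp_le_bellmanValue (M : RobustMDP Q A) {safe tgt : Set Q} {q : Q} (ht : q ∉ tgt)
    (hs : q ∈ safe) {a : A} (ha : a ∈ M.avail q) :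
    M.worstExp (M.bellmanValue safe tgt) q a ≤ M.bellmanValue safe tgt q := by
  rw [bellmanValue_eq_iSup M ht hs]
  exact le_iSup₂_of_le a ha le_rfl

lemma worstExp_eq_bellmanValue (M : RobustMDP Q A) {safe tgt : Set Q} {q : Q} (ht : q ∉ tgt)
    (hs : q ∈ safe) {a : A} (ha : a ∈ M.argmaxActions (M.bellmanValue safe tgt) q) :
    M.worstExp (M.bellmanValue safe tgt) q a = M.bellmanValue safe tgt q := by
  refine le_antisymm (worstExp_le_bellmanValue M ht hs ha.1) ?_
  conv_lhs => rw [bellmanValue_eq_iSup M ht hs]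
  exact iSup₂_le ha.2

/-- Every supersolution of the Bellman equation lies above the least fixed point. -/
lemma bellmanValue_le (M : RobustMDP Q A) {safe tgt : Set Q} {W : Q → ℝ≥0∞}
    (h1 : ∀ q ∈ tgt, 1 ≤ W q)
    (h : ∀ q ∉ tgt, q ∈ safe → ∀ a ∈ M.avail q, M.worstExp W q a ≤ W q) :
    M.bellmanValue safe tgt ≤ W := by
  refine (M.bellman safe tgt).lfp_le fun q => ?_
  by_cases ht : q ∈ tgt
  · simpa [bellman_apply, ht] using h1 q ht
  by_cases hs : q ∈ safe
  · simpa [bellman_apply, ht, hs] using h q ht hs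
  · simp [bellman_apply, ht, hs]

lemma bellmanValue_le_one (M : RobustMDP Q A) (safe tgt : Set Q) (q : Q) :
    M.bellmanValue safe tgt q ≤ 1 :=
  M.bellmanValue_le (W := fun _ => 1) (fun _ _ => le_rfl)
    (fun _ _ _ _ ha => M.worstExp_le_one (fun _ => le_rfl) ha) q

/-- An adversary which almost attains the worst-case expectation of the Bellman value in every step
keeps the reach-avoid probability below the Bellman value. -/
lemma optReachProb_le_bellmanValue [MeasurableSpace Q] [DiscreteMeasurableSpace Q]
    (M : RobustMDP Q A) {safe tgt : Set Q} (hts : tgt ⊆ safe) (q : Q) :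
    M.optReachProb safe tgt q ≤ M.bellmanValue safe tgt q := by
  set U := M.bellmanValue safe tgt
  refine iSup_le fun σ => ENNReal.le_of_forall_pos_le_add fun ε hε _ => ?_
  -- Infima over the ambiguity sets need not be attained, so the step at time `n` may lose `e n`,
  -- with total loss below `ε`.
  obtain ⟨e, he, hesum⟩ := ENNReal.exists_pos_sum_of_countable' (ε := (ε : ℝ≥0∞))
    (by simpa using hε.ne') ℕ
  have hex : ∀ (ω : FinPath Q A) (a : A), ∃ γ : PMF Q, a ∈ M.avail ω.last →
      γ ∈ M.Γ ω.last a ∧ ∑ r, γ r * U r ≤ M.worstExp U ω.last a + e ω.length := by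
    intro ω a
    by_cases ha : a ∈ M.avail ω.last
    · have hlt : M.worstExp U ω.last a < M.worstExp U ω.last a + e ω.length :=
        ENNReal.lt_add_right (ne_top_of_le_ne_top ENNReal.one_ne_top
          (M.worstExp_le_one (M.bellmanValue_le_one safe tgt) ha)) (he _).ne'
      obtain ⟨γ, hγ⟩ := iInf_lt_iff.1 hlt
      obtain ⟨hγm, hγ⟩ := iInf_lt_iff.1 hγ
      exact ⟨γ, fun _ => ⟨hγm, hγ.le⟩⟩
    · exact ⟨PMF.pure q, fun h => absurd h ha⟩
  choose f hf using hex
  let ξ : M.Adversary := ⟨f, fun ω a ha => (hf ω a ha).1⟩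
  refine (iInf_le _ ξ).trans (M.reachProb_le_of_stoppedValue_le (W := U) σ ξ q fun n => ?_)
  refine (M.lintegral_stoppedValue_le (fun r hr => M.bellmanValue_of_mem_tgt hr)
    (fun r hr => M.bellmanValue_of_notMem_safe hts hr) σ ξ e (fun n ω ht hs => ?_) q n).trans ?_
  · refine (hf _ _ (σ.act_mem (σ.hist n ω))).2.trans ?_
    have hav := σ.act_mem (σ.hist n ω)
    rw [σ.length_hist]
    rw [σ.last_hist] at hav ⊢
    gcongr
    exact M.worstExp_le_bellmanValue ht hs hav
  · gcongr
    exact (ENNReal.sum_le_tsum _).trans hesum.le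

/-- If no maximizing action outside `S` moves into `S` with positive worst-case probability, the
Bellman value vanishes outside `S`. -/
lemma bellmanValue_eq_zero_of_closed [Finite A] (M : RobustMDP Q A) {safe tgt S : Set Q}
    (htS : tgt ⊆ S)
    (hS : ∀ q ∉ S, ∀ a ∈ M.argmaxActions (M.bellmanValue safe tgt) q, M.worstMass S q a = 0)
    {q : Q} (hq : q ∉ S) : M.bellmanValue safe tgt q = 0 := by
  classical
  set U := M.bellmanValue safe tgt with hU
  by_contra hne
  obtain ⟨p, hpS, hpmax⟩ := (Set.toFinite Sᶜ).exists_maximalFor U Sᶜ ⟨q, hq⟩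
  replace hpmax : ∀ r ∉ S, U r ≤ U p := fun r hr => by
    rcases le_total (U r) (U p) with h | h
    · exact h
    · exact hpmax hr h
  have hp0 : U p ≠ 0 := fun h => hne (le_antisymm ((hpmax q hq).trans_eq h) zero_le)
  -- Choose `c` just below the maximum `U p` of `U` outside `S`, above all smaller values of `U` and
  -- all worst-case expectations below `U p`. Finiteness of `Q` and `A` provides this gap.
  have : (𝓝[<] (U p)).NeBot := nhdsLT_neBot_of_exists_lt ⟨0, pos_iff_ne_zero.2 hp0⟩
  have hlt : ∀ x : ℝ≥0∞, x < U p → ∀ᶠ c in 𝓝[<] (U p), x ≤ c := fun x hx =>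
    (Ioo_mem_nhdsLT hx |> Filter.mem_of_superset <| fun c hc => hc.1.le)
  have hev1 : ∀ᶠ c in 𝓝[<] (U p), ∀ r, U r < U p → U r ≤ c :=
    eventually_all.2 fun r => by
      by_cases h : U r < U p
      · exact (hlt _ h).mono fun c hc _ => hc
      · exact Eventually.of_forall fun c hc => absurd hc h
  have hev2 : ∀ᶠ c in 𝓝[<] (U p), ∀ r, ∀ a, M.worstExp U r a < U p → M.worstExp U r a ≤ c :=
    eventually_all.2 fun r => eventually_all.2 fun a => by
      by_cases h : M.worstExp U r a < U p
      · exact (hlt _ h).mono fun c hc _ => hc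
      · exact Eventually.of_forall fun c hc => absurd hc h
  obtain ⟨c, hc1, hc2, hcp⟩ := (hev1.and (hev2.and self_mem_nhdsWithin)).exists
  replace hcp : c < U p := hcp
  -- Truncating `U` at `c` outside `S` leaves a supersolution, so leastness gives `U ≤ W`, which
  -- fails at `p`.
  let W : Q → ℝ≥0∞ := fun r => if r ∈ S then U r else min (U r) c
  have hWU : W ≤ U := fun r => by
    by_cases hr : r ∈ S <;> simp [W, hr]
  have hUW : U ≤ W := by
    refine M.bellmanValue_le (fun r hr => ?_) fun r ht hs a ha => ?_
    · simp [W, htS hr, hU, M.bellmanValue_of_mem_tgt hr]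
    have hle : M.worstExp W r a ≤ U r :=
      (M.worstExp_mono hWU r a).trans (M.worstExp_le_bellmanValue ht hs ha)
    by_cases hrS : r ∈ S
    · simpa [W, hrS] using hle
    simp only [W, hrS, if_false]
    refine le_min hle ?_
    rcases (hpmax r hrS).lt_or_eq with hr | hr
    · exact hle.trans (hc1 r hr)
    -- At a top state, a maximizing action can be answered with arbitrarily little mass in `S`, so
    -- its worst-case mean of `W` is at most `c`; any other action has worst-case mean below `U p`,
    -- hence at most `c`.
    by_cases hmax : a ∈ M.argmaxActions U r
    · have h0 := hS r hrS a hmax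
      refine ENNReal.le_of_forall_pos_le_add fun ε hε _ => ?_
      have : M.worstMass S r a < ε := by rw [h0]; exact_mod_cast hε
      obtain ⟨γ, hγ⟩ := iInf_lt_iff.1 this
      obtain ⟨hγm, hγ⟩ := iInf_lt_iff.1 hγ
      refine (iInf₂_le γ hγm).trans ?_
      calc ∑ s, γ s * W s ≤ ∑ s, (γ s * c + S.indicator (fun r => γ r) s) := by
            refine Finset.sum_le_sum fun s _ => ?_
            by_cases hs : s ∈ S
            · simp only [hs, Set.indicator_of_mem]
              refine le_add_left ?_
              exact mul_le_of_le_one_right' ((hWU s).trans (M.bellmanValue_le_one _ _ _))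
            · simp only [W, hs, if_false, Set.indicator_of_notMem, not_false_iff, add_zero]
              exact mul_le_mul_right (min_le_right _ _) _
        _ = c + ∑ s, S.indicator (fun r => γ r) s := by
            rw [Finset.sum_add_distrib, sum_pmf_mul_const]
        _ ≤ c + ε := by gcongr
    · refine (M.worstExp_mono hWU r a).trans (hc2 r a ?_)
      rw [← hr]
      refine lt_of_le_of_ne (M.worstExp_le_bellmanValue ht hs ha) fun heq => hmax ⟨ha, ?_⟩
      intro b hb
      rw [heq]
      exact M.worstExp_le_bellmanValue ht hs hb
  have := hUW p
  simp only [W, if_neg hpS] at this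
  exact absurd (this.trans (min_le_right _ _)) (not_le.2 hcp)

end Bellman

/-! ### Backward layers and the drift function -/

section Backward

variable [Fintype Q]

/-- The nested backward-reachable sets for the value function `V`. -/
def backwardSets (M : RobustMDP Q A) (V : Q → ℝ≥0∞) (tgt : Set Q) : ℕ → Set Q
  | 0 => tgt
  | m + 1 => M.backwardSets V tgt m ∪
      {q | q ∉ M.backwardSets V tgt m ∧
        {a | a ∈ M.argmaxActions V q ∧ 0 < M.worstMass (M.backwardSets V tgt m) q a}.Nonempty}

lemma nested_eq_backwardSets [MeasurableSpace Q] [DiscreteMeasurableSpace Q]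
    (M : RobustMDP Q A) (safe tgt : Set Q) (m : ℕ) :
    M.nested safe tgt m = M.backwardSets (M.optReachProb safe tgt) tgt m := by
  induction m with
  | zero => rfl
  | succ m ih =>
    rw [nested, backwardSets, ih]
    rfl

lemma backwardSets_mono (M : RobustMDP Q A) (V : Q → ℝ≥0∞) (tgt : Set Q) :
    Monotone (M.backwardSets V tgt) :=
  monotone_nat_of_le_succ fun _ => Set.subset_union_left

lemma exists_backwardSets_eq (M : RobustMDP Q A) (V : Q → ℝ≥0∞) (tgt : Set Q) :
    ∃ m, 1 ≤ m ∧ M.backwardSets V tgt m = M.backwardSets V tgt (m - 1) := by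
  obtain ⟨n, hn⟩ := WellFoundedGT.monotone_chain_condition
    (⟨M.backwardSets V tgt, M.backwardSets_mono V tgt⟩ : ℕ →o Set Q)
  exact ⟨n + 1, by omega, (hn (n + 1) (by omega)).symm⟩

lemma backwardSets_eq_of_le (M : RobustMDP Q A) (V : Q → ℝ≥0∞) (tgt : Set Q) {m : ℕ}
    (h : M.backwardSets V tgt (m + 1) = M.backwardSets V tgt m) {n : ℕ} (hn : m ≤ n) :
    M.backwardSets V tgt n = M.backwardSets V tgt m := by
  induction n, hn using Nat.le_induction with
  | base => rfl
  | succ n _ ih => rw [← h, backwardSets, backwardSets, ih]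

/-- Membership in exactly one layer `Q^m \ Q^{m-1}`. -/
lemma existsUnique_layer (M : RobustMDP Q A) (V : Q → ℝ≥0∞) {tgt : Set Q} {N : ℕ} {q : Q}
    (hq : q ∈ M.backwardSets V tgt N) (ht : q ∉ tgt) :
    ∃! m, 1 ≤ m ∧ m ≤ N ∧ q ∈ M.backwardSets V tgt m \ M.backwardSets V tgt (m - 1) := by
  classical
  have hex : ∃ m, q ∈ M.backwardSets V tgt m := ⟨N, hq⟩
  have hpos : 1 ≤ Nat.find hex := by
    rw [Nat.one_le_iff_ne_zero]
    intro h0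
    have := Nat.find_spec hex
    rw [h0] at this
    exact ht this
  refine ⟨Nat.find hex, ⟨hpos, Nat.find_min' hex hq, Nat.find_spec hex,
    Nat.find_min hex (by omega)⟩, ?_⟩
  rintro m ⟨hm1, -, hm, hm'⟩
  refine le_antisymm ?_ (Nat.find_min' hex hm)
  by_contra hlt
  exact hm' (M.backwardSets_mono V tgt (by omega) (Nat.find_spec hex))

/-- In every layer, `σ` maximizes the worst-case expectation of `V` and moves to a lower layer with
positive worst-case probability. -/
def MakesProgress (M : RobustMDP Q A) (V : Q → ℝ≥0∞) (tgt : Set Q) (σ : M.StationaryStrategy) :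
    Prop :=
  ∀ m, ∀ q ∈ M.backwardSets V tgt (m + 1) \ M.backwardSets V tgt m,
    σ.act q ∈ M.argmaxActions V q ∧ 0 < M.worstMass (M.backwardSets V tgt m) q (σ.act q)

lemma exists_makesProgress (M : RobustMDP Q A) (V : Q → ℝ≥0∞) (tgt : Set Q) :
    ∃ σ : M.StationaryStrategy, M.MakesProgress V tgt σ := by
  have hex : ∀ q, ∃ a ∈ M.avail q,
      ∀ m, q ∈ M.backwardSets V tgt (m + 1) \ M.backwardSets V tgt m →
        a ∈ M.argmaxActions V q ∧ 0 < M.worstMass (M.backwardSets V tgt m) q a := by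
    intro q
    by_cases hq : ∃ m, q ∈ M.backwardSets V tgt (m + 1) \ M.backwardSets V tgt m
    · obtain ⟨m, hm⟩ := hq
      obtain ⟨a, ha, ha'⟩ := (hm.1.resolve_left hm.2).2
      refine ⟨a, ha.1, fun n hn => ?_⟩
      have ht : q ∉ tgt := fun h => hm.2 (M.backwardSets_mono V tgt (Nat.zero_le m) h)
      -- The action chosen for layer `m` serves every `n`, since a state has only one layer.
      have hu := (M.existsUnique_layer V (M.backwardSets_mono V tgt
        (le_max_left (m + 1) (n + 1)) hm.1) ht).unique
        ⟨by omega, le_max_left _ _, hm⟩ ⟨by omega, le_max_right _ _, hn⟩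
      obtain rfl : m = n := by omega
      exact ⟨ha, ha'⟩
    · obtain ⟨a, ha⟩ := M.avail_nonempty q
      exact ⟨a, ha, fun m hm => absurd ⟨m, hm⟩ hq⟩
  choose f hf hf' using hex
  exact ⟨⟨f, hf⟩, fun m q hq => hf' q m hq⟩

lemma sum_indicator_mul_le {V : Q → ℝ≥0∞} {S : Set Q} {c : ℝ≥0∞} (h : ∀ q ∈ S, c ≤ V q)
    (γ : PMF Q) : (∑ r, S.indicator (fun s => γ s) r) * c ≤ ∑ r, γ r * V r := by
  rw [Finset.sum_mul]
  refine Finset.sum_le_sum fun r _ => ?_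
  by_cases hr : r ∈ S
  · simpa [hr] using mul_le_mul_right (h r hr) _
  · simp [hr]

lemma worstMass_mul_le {M : RobustMDP Q A} {V : Q → ℝ≥0∞} {S : Set Q} {c : ℝ≥0∞}
    (h : ∀ q ∈ S, c ≤ V q) {q : Q} {a : A} {γ : PMF Q} (hγ : γ ∈ M.Γ q a) :
    M.worstMass S q a * c ≤ ∑ r, γ r * V r :=
  (mul_le_mul_left (iInf₂_le γ hγ) c).trans (sum_indicator_mul_le h γ)

lemma exists_pos_forall_le {ι : Type*} [Finite ι] (f : ι → ℝ≥0∞) :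
    ∃ c : ℝ≥0∞, 0 < c ∧ c ≤ 1 ∧ ∀ i, 0 < f i → c ≤ f i := by
  have hlt : ∀ x : ℝ≥0∞, 0 < x → ∀ᶠ c in 𝓝[>] (0 : ℝ≥0∞), c ≤ x := fun x hx =>
    Filter.mem_of_superset (Ioo_mem_nhdsGT hx) fun c hc => hc.2.le
  have hev : ∀ᶠ c in 𝓝[>] (0 : ℝ≥0∞), ∀ i, 0 < f i → c ≤ f i :=
    eventually_all.2 fun i => by
      by_cases h : 0 < f i
      · exact (hlt _ h).mono fun c hc _ => hc
      · exact Eventually.of_forall fun c hc => absurd hc h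
  obtain ⟨c, h1, h2, h3⟩ := ((hlt 1 one_pos).and (hev.and self_mem_nhdsWithin)).exists
  exact ⟨c, h3, h1, h2⟩

/-- All mass from `qu` stays at `qu`, which by induction is outside the previous set. -/
lemma notMem_backwardSets_of_absorbing (M : RobustMDP Q A) (V : Q → ℝ≥0∞) {tgt : Set Q} {qu : Q}
    (habs : ∀ a ∈ M.avail qu, M.Γ qu a = {PMF.pure qu}) (hqu : qu ∉ tgt) (m : ℕ) :
    qu ∉ M.backwardSets V tgt m := by
  classical
  induction m with
  | zero => exact hqu
  | succ m ih =>
    rintro (h | ⟨-, a, ha, hpos⟩)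
    · exact ih h
    · refine hpos.ne' ?_
      unfold worstMass
      rw [habs a ha.1]
      simp only [Set.mem_singleton_iff, iInf_iInf_eq_left]
      refine Finset.sum_eq_zero fun r _ => ?_
      by_cases hr : r ∈ M.backwardSets V tgt m
      · have : r ≠ qu := fun h => ih (h ▸ hr)
        simp [hr, this]
      · simp [hr]

/-- The backward-reachable sets cover exactly the states of positive Bellman value. -/
lemma backwardSets_eq_pos [Finite A] (M : RobustMDP Q A) {tgt : Set Q} {qu : Q}
    (habs : ∀ a ∈ M.avail qu, M.Γ qu a = {PMF.pure qu}) (htgt : tgt ⊆ {qu}ᶜ) {m : ℕ}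
    (hm : M.backwardSets (M.bellmanValue {qu}ᶜ tgt) tgt (m + 1) =
      M.backwardSets (M.bellmanValue {qu}ᶜ tgt) tgt m) :
    M.backwardSets (M.bellmanValue {qu}ᶜ tgt) tgt m = {q | 0 < M.bellmanValue {qu}ᶜ tgt q} := by
  set U := M.bellmanValue {qu}ᶜ tgt
  have hqu : qu ∉ tgt := fun h => htgt h rfl
  refine Set.Subset.antisymm ?_ fun q (hq : 0 < U q) => by_contra fun hqm => hq.ne' ?_
  -- Positivity on every layer needs no stabilization: positive mass times the least positive value
  -- below bounds the value from below.
  · clear hm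
    induction m with
    | zero => exact fun q hq => one_pos.trans_eq (M.bellmanValue_of_mem_tgt hq).symm
    | succ m ih =>
      rintro q (hq | ⟨hq, a, ha, hpos⟩)
      · exact ih hq
      have hne : q ≠ qu := by
        rintro rfl
        exact M.notMem_backwardSets_of_absorbing U habs hqu (m + 1) (Or.inr ⟨hq, a, ha, hpos⟩)
      have ht : q ∉ tgt := fun h => hq (M.backwardSets_mono U tgt (Nat.zero_le m) h)
      obtain ⟨c, hc0, -, hc⟩ := exists_pos_forall_le U
      have hle : M.worstMass (M.backwardSets U tgt m) q a * c ≤ M.worstExp U q a :=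
        le_iInf₂ fun γ hγ => worstMass_mul_le (fun r hr => hc r (ih hr)) hγ
      exact (ENNReal.mul_pos hpos.ne' hc0.ne').trans_le
        (hle.trans (M.worstExp_le_bellmanValue ht hne ha.1))
  · refine M.bellmanValue_eq_zero_of_closed (S := M.backwardSets U tgt m)
      (M.backwardSets_mono U tgt (Nat.zero_le m)) (fun r hr a ha => ?_) hqm
    by_contra hne
    exact hr (hm ▸ Or.inr ⟨hr, a, ha, pos_iff_ne_zero.2 hne⟩)

/-- A strategy that makes progress admits a bounded function of the state which increases in
expectation outside `tgt ∪ {qu}`, by a constant amount on the backward-reachable sets. -/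
lemma exists_drift (M : RobustMDP Q A) (V : Q → ℝ≥0∞) {tgt : Set Q} {qu : Q}
    (hqu : ∀ m, qu ∉ M.backwardSets V tgt m) {σ : M.StationaryStrategy}
    (hσ : M.MakesProgress V tgt σ) (N : ℕ) :
    ∃ (d : Q → ℝ≥0∞) (c : ℝ≥0∞), c ≠ 0 ∧ c ≤ 1 ∧ (∀ q, d q ≤ 2) ∧ d qu = 2 ∧
      (∀ q ∈ tgt, d q ≤ 1) ∧
      ∀ q, q ∉ tgt → q ≠ qu → ∀ γ ∈ M.Γ q (σ.act q),
        d q + (M.backwardSets V tgt N).indicator (fun _ => c) q ≤ ∑ r, γ r * d r := by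
  classical
  set B := M.backwardSets V tgt with hB
  obtain ⟨η, hη0, hη1, hη⟩ := exists_pos_forall_le
    (fun x : Fin N × Q => M.worstMass (B x.1) x.2 (σ.act x.2))
  have hθ1 : η / 2 ≤ 1 := ENNReal.half_le_self.trans hη1
  have hθ0 : η / 2 ≠ 0 := (ENNReal.half_pos hη0.ne').ne'
  have h2 : η = 2 * (η / 2) := (ENNReal.mul_div_cancel two_ne_zero ENNReal.ofNat_ne_top).symm
  let rank : Q → ℕ := fun q => sInf {m | q ∈ B m}
  have hrank_le : ∀ {q m}, q ∈ B m → rank q ≤ m := fun h => Nat.sInf_le h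
  have hrank_mem : ∀ {q m}, q ∈ B m → q ∈ B (rank q) := fun {q m} h =>
    Nat.sInf_mem (s := {m | q ∈ B m}) ⟨m, h⟩
  -- With `θ = η / 2`, a step from layer `m + 1` has mean at least `η * θ ^ m = 2 * θ ^ (m + 1)`,
  -- twice the current value; the surplus covers `c = θ ^ N`. The value `2` at `qu` yields a gain of
  -- at least `1` when a target is redirected there.
  let d : Q → ℝ≥0∞ := fun q =>
    if q = qu then 2 else if q ∈ B N then (η / 2) ^ rank q else 0
  have hpow : ∀ k, (η / 2) ^ k ≤ 1 := fun k => pow_le_one₀ zero_le hθ1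
  have hd1 : ∀ q, q ≠ qu → d q ≤ 1 := fun q hq => by
    by_cases hm : q ∈ B N
    · simpa [d, hq, hm] using hpow _
    · simp [d, hq, hm]
  have htu : ∀ q ∈ tgt, q ≠ qu := fun q hq h => hqu 0 (h ▸ hq)
  refine ⟨d, (η / 2) ^ N, pow_ne_zero _ hθ0, hpow N, fun q => ?_, by simp [d],
    fun q hq => hd1 q (htu q hq), fun q ht hq γ hγ => ?_⟩
  · by_cases hq : q = qu
    · simp [d, hq]
    · exact (hd1 q hq).trans one_le_two
  by_cases hm : q ∈ B N
  swap
  · simp [d, hq, hm]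
  obtain ⟨m, hmr⟩ : ∃ m, rank q = m + 1 := by
    refine Nat.exists_eq_succ_of_ne_zero fun h0 => ht ?_
    have := hrank_mem hm
    rwa [h0] at this
  have hmN : m < N := by have := hrank_le hm; omega
  have hq1 : q ∈ B (m + 1) := hmr ▸ hrank_mem hm
  have hq2 : q ∉ B m := fun h => by have := hrank_le h; omega
  have hprog := hη (⟨m, hmN⟩, q) (hσ m q ⟨hq1, hq2⟩).2
  have hdlow : ∀ r ∈ B m, (η / 2) ^ m ≤ d r := by
    intro r hr
    have hrN : r ∈ B N := M.backwardSets_mono V tgt hmN.le hr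
    have hru : r ≠ qu := fun h => hqu m (h ▸ hr)
    simp only [d, hru, hrN, if_true, if_false]
    exact pow_le_pow_right_of_le_one' hθ1 (hrank_le hr)
  calc d q + (B N).indicator (fun _ => (η / 2) ^ N) q
      = (η / 2) ^ (m + 1) + (η / 2) ^ N := by simp [d, hq, hm, hmr]
    _ ≤ (η / 2) ^ (m + 1) + (η / 2) ^ (m + 1) := by
        exact add_le_add_right (pow_le_pow_right_of_le_one' hθ1 hmN) _
    _ = η * (η / 2) ^ m := by
        rw [← two_mul, pow_succ', ← mul_assoc, ← h2]
    _ ≤ M.worstMass (B m) q (σ.act q) * (η / 2) ^ m := by gcongr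
    _ ≤ ∑ r, γ r * d r := worstMass_mul_le hdlow hγ

/-! ### Attainment of the value and properness -/

section PathLaw

variable [MeasurableSpace Q] [DiscreteMeasurableSpace Q] [Finite A]

/-- A strategy that makes progress with respect to the Bellman value attains it. -/
lemma bellmanValue_le_worstReachProb (M : RobustMDP Q A) {tgt : Set Q} {qu : Q}
    (habs : ∀ a ∈ M.avail qu, M.Γ qu a = {PMF.pure qu}) (htgt : tgt ⊆ {qu}ᶜ)
    {σ : M.StationaryStrategy} (hσ : M.MakesProgress (M.bellmanValue {qu}ᶜ tgt) tgt σ) (q : Q) :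
    M.bellmanValue {qu}ᶜ tgt q ≤ M.worstReachProb {qu}ᶜ tgt σ.toStrategy q := by
  set U := M.bellmanValue {qu}ᶜ tgt
  have hqu : qu ∉ tgt := fun h => htgt h rfl
  obtain ⟨N, hN1, hN⟩ := M.exists_backwardSets_eq U tgt
  obtain ⟨N, rfl⟩ : ∃ k, N = k + 1 := ⟨N - 1, by omega⟩
  have hpos := M.backwardSets_eq_pos habs htgt hN
  obtain ⟨d, c, hc0, -, hd2, -, -, hdrift⟩ := M.exists_drift U
    (M.notMem_backwardSets_of_absorbing U habs hqu) hσ N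
  set R := M.backwardSets U tgt N
  have hUR : ∀ r ∉ R, U r = 0 := fun r hr => by
    by_contra hne
    exact hr (hpos ▸ pos_iff_ne_zero.2 hne)
  refine le_iInf fun ξ => ?_
  set P := M.pathMeasure σ.toStrategy ξ q
  set T : Set Q := tgt ∪ {qu}ᶜᶜ
  have hmem := M.nextDist_toStrategy_mem σ ξ
  have hlim := M.tendsto_measure_avoids_mem σ.toStrategy ξ q T R (by simp : (2 : ℝ≥0∞) ≠ ∞)
    hc0 hd2 fun n ω hω => hdrift (ω n) (fun h => hω (Or.inl h)) (fun h => hω (Or.inr (by simp [h])))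
      _ (hmem n ω)
  -- Undecided paths contribute at most `1` on `R` and nothing outside it, where `U` vanishes.
  have hbound : ∀ n, U q ≤ M.reachProb {qu}ᶜ tgt σ.toStrategy ξ q +
      P {ω | Avoids T n ω ∧ ω n ∈ R} := by
    intro n
    have hmeas : MeasurableSet {ω : ℕ → Q | Avoids T n ω ∧ ω n ∈ R} :=
      measurableSet_of_dependsOn_Iic (n := n) fun x y hxy => by
        simp only [dependsOn_avoids T n hxy, hxy n (Set.mem_Iic.2 le_rfl)]
    have hmeas' := measurableSet_of_dependsOn_Iic (dependsOn_reachedBy ({qu}ᶜ : Set Q) tgt n)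
    have hlow := M.le_lintegral_stoppedValue (safe := {qu}ᶜ) (tgt := tgt) (W := U)
      (fun r hr => M.bellmanValue_of_mem_tgt hr)
      (fun r hr => M.bellmanValue_of_notMem_safe htgt hr) σ.toStrategy ξ (fun n ω ht => ?_) q n
    · refine hlow.trans (le_trans ?_ (add_le_add_left
        (M.measure_reachedBy_le_reachProb {qu}ᶜ tgt σ.toStrategy ξ q n) _))
      rw [← lintegral_indicator_one hmeas, ← lintegral_indicator_one hmeas',
        ← lintegral_add_right _ (measurable_one.indicator hmeas)]
      refine lintegral_mono fun ω => ?_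
      by_cases hr : ReachedBy {qu}ᶜ tgt n ω
      · simp [stoppedValue, hr]
      unfold stoppedValue
      rw [if_neg hr]
      split_ifs with ha
      · by_cases hR : ω n ∈ R
        · refine (M.bellmanValue_le_one _ _ _).trans (le_add_left (le_of_eq ?_))
          have hmem' : ω ∈ {ω : ℕ → Q | Avoids T n ω ∧ ω n ∈ R} := ⟨ha, hR⟩
          rw [Set.indicator_of_mem hmem', Pi.one_apply]
        · simp [hUR _ hR]
      · exact zero_le
    · by_cases hR : ω n ∈ R
      · have hne : ω n ≠ qu := fun h =>
          M.notMem_backwardSets_of_absorbing U habs hqu N (h ▸ hR)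
        obtain ⟨m, ⟨hm1, -, hm⟩, -⟩ := M.existsUnique_layer U hR ht
        obtain ⟨m, rfl⟩ : ∃ k, m = k + 1 := ⟨m - 1, by omega⟩
        refine (M.worstExp_eq_bellmanValue ht hne (hσ m _ hm).1).ge.trans ?_
        exact iInf₂_le _ (hmem n ω)
      · rw [hUR _ hR]
        exact zero_le
  have := ge_of_tendsto' (tendsto_const_nhds.add hlim) hbound
  rwa [add_zero] at this

/-- The optimal reach-avoid probability is the least fixed point of the Bellman operator. -/
lemma optReachProb_eq_bellmanValue (M : RobustMDP Q A) {tgt : Set Q} {qu : Q}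
    (habs : ∀ a ∈ M.avail qu, M.Γ qu a = {PMF.pure qu}) (htgt : tgt ⊆ {qu}ᶜ) :
    M.optReachProb {qu}ᶜ tgt = M.bellmanValue {qu}ᶜ tgt := by
  funext q
  obtain ⟨σ, hσ⟩ := M.exists_makesProgress (M.bellmanValue {qu}ᶜ tgt) tgt
  exact le_antisymm (M.optReachProb_le_bellmanValue htgt q)
    ((M.bellmanValue_le_worstReachProb habs htgt hσ q).trans
      (le_iSup (fun τ : M.Strategy => M.worstReachProb {qu}ᶜ tgt τ q) σ.toStrategy))

/-- After redirection the drift inequality holds at every state, including targets and `qu`, so the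
drift criterion applies with `T = ∅`. -/
lemma isProper_of_makesProgress (M : RobustMDP Q A) {tgt : Set Q} {qu : Q}
    (habs : ∀ a ∈ M.avail qu, M.Γ qu a = {PMF.pure qu}) (htgt : tgt ⊆ {qu}ᶜ)
    {σ : M.StationaryStrategy} (hσ : M.MakesProgress (M.optReachProb {qu}ᶜ tgt) tgt σ) :
    M.IsProper tgt qu σ := by
  classical
  have hV := M.optReachProb_eq_bellmanValue habs htgt
  rw [hV] at hσ
  set U := M.bellmanValue {qu}ᶜ tgt
  have hqu : qu ∉ tgt := fun h => htgt h rfl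
  obtain ⟨N, hN1, hN⟩ := M.exists_backwardSets_eq U tgt
  obtain ⟨N, rfl⟩ : ∃ k, N = k + 1 := ⟨N - 1, by omega⟩
  have hpos := M.backwardSets_eq_pos habs htgt hN
  obtain ⟨d, c, hc0, hc1, hd2, hdqu, hdt, hdrift⟩ := M.exists_drift U
    (M.notMem_backwardSets_of_absorbing U habs hqu) hσ N
  have hR : M.reachSet {qu}ᶜ tgt = M.backwardSets U tgt N := by
    rw [hpos, reachSet, hV]
  intro q ξ
  rw [hR]
  have hlim := (M.redirect tgt qu).tendsto_measure_avoids_mem (σ.redirect tgt qu).toStrategy ξ q ∅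
    (M.backwardSets U tgt N) (by simp : (2 : ℝ≥0∞) ≠ ∞) hc0 hd2 fun n ω _ => ?_
  · simpa [Avoids] using hlim
  have hmem := (M.redirect tgt qu).nextDist_toStrategy_mem (σ.redirect tgt qu) ξ n ω
  generalize (M.redirect tgt qu).nextDist (σ.redirect tgt qu).toStrategy ξ n ω = γ at hmem ⊢
  by_cases ht : ω n ∈ tgt
  · obtain rfl : γ = PMF.pure qu := by simpa [redirect, ht] using hmem
    calc _ ≤ (1 : ℝ≥0∞) + 1 := add_le_add (hdt _ ht)
          ((Set.indicator_le_self' (fun _ _ => zero_le) _).trans hc1)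
      _ = _ := by simp [PMF.pure_apply, hdqu, one_add_one_eq_two]
  replace hmem : γ ∈ M.Γ (ω n) (σ.act (ω n)) := by
    simpa [redirect, ht, StationaryStrategy.redirect] using hmem
  by_cases hωu : ω n = qu
  · have hn := M.notMem_backwardSets_of_absorbing U habs hqu N
    have hact := σ.act_mem (ω n)
    rw [hωu] at hmem hact ⊢
    rw [habs _ hact] at hmem
    obtain rfl := hmem
    simp [PMF.pure_apply, hdqu, hn]
  · exact hdrift _ ht hωu _ hmem

end PathLaw

end Backward

/-! ### Transfer to `nested` and `mMax` -/

variable [Fintype Q] [MeasurableSpace Q] [DiscreteMeasurableSpace Q]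

lemma mMax_spec (M : RobustMDP Q A) (safe tgt : Set Q) :
    1 ≤ M.mMax safe tgt ∧
      M.nested safe tgt (M.mMax safe tgt) = M.nested safe tgt (M.mMax safe tgt - 1) := by
  refine Nat.sInf_mem (s := {m | 1 ≤ m ∧ M.nested safe tgt m = M.nested safe tgt (m - 1)}) ?_
  obtain ⟨m, hm, h⟩ := M.exists_backwardSets_eq (M.optReachProb safe tgt) tgt
  exact ⟨m, hm, by rw [nested_eq_backwardSets, nested_eq_backwardSets, h]⟩

/-- The two conditions differ only in layers beyond `mMax`, which are empty because the sets have
stabilized. -/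
lemma isBackwardStrategy_iff_makesProgress (M : RobustMDP Q A) (safe tgt : Set Q)
    (σ : M.StationaryStrategy) :
    M.IsBackwardStrategy safe tgt σ ↔ M.MakesProgress (M.optReachProb safe tgt) tgt σ := by
  obtain ⟨h1, h⟩ := M.mMax_spec safe tgt
  unfold IsBackwardStrategy MakesProgress
  simp only [nested_eq_backwardSets] at h ⊢
  constructor
  · intro hσ m q hq
    refine hσ (m + 1) (by omega) ?_ q hq
    by_contra hlt
    obtain ⟨k, hk⟩ : ∃ k, M.mMax safe tgt = k + 1 := ⟨M.mMax safe tgt - 1, by omega⟩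
    rw [hk] at h
    have hm := M.backwardSets_eq_of_le _ tgt h (by omega : k ≤ m)
    have hm' := M.backwardSets_eq_of_le _ tgt h (by omega : k ≤ m + 1)
    exact hq.2 (by rw [hm, ← hm']; exact hq.1)
  · intro hσ m hm _ q hq
    obtain ⟨m, rfl⟩ : ∃ k, m = k + 1 := ⟨m - 1, by omega⟩
    exact hσ m q hq

/-- A strategy that makes progress maximizes the worst-case expectation of the value at every state
of the redirected robust MDP. -/
lemma act_mem_argmaxActions_redirect [Finite A] (M : RobustMDP Q A) {tgt : Set Q} {qu : Q}
    (habs : ∀ a ∈ M.avail qu, M.Γ qu a = {PMF.pure qu}) (htgt : tgt ⊆ {qu}ᶜ)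
    {σ : M.StationaryStrategy} (hσ : M.MakesProgress (M.optReachProb {qu}ᶜ tgt) tgt σ) (q : Q) :
    σ.act q ∈ (M.redirect tgt qu).argmaxActions (M.optReachProb {qu}ᶜ tgt) q := by
  rw [M.optReachProb_eq_bellmanValue habs htgt] at hσ ⊢
  set U := M.bellmanValue {qu}ᶜ tgt
  by_cases ht : q ∈ tgt
  · exact ⟨σ.act_mem q, fun b _ => by simp [worstExp, redirect, ht]⟩
  have hexp : ∀ a, (M.redirect tgt qu).worstExp U q a = M.worstExp U q a := fun a => by
    simp [worstExp, redirect, ht]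
  suffices h : σ.act q ∈ M.argmaxActions U q by
    refine ⟨h.1, fun b hb => ?_⟩
    rw [hexp, hexp]
    exact h.2 b hb
  obtain ⟨N, hN1, hN⟩ := M.exists_backwardSets_eq U tgt
  obtain ⟨N, rfl⟩ : ∃ k, N = k + 1 := ⟨N - 1, by omega⟩
  have hpos := M.backwardSets_eq_pos habs htgt hN
  by_cases hq : q ∈ M.backwardSets U tgt N
  · obtain ⟨m, ⟨hm1, -, hm⟩, -⟩ := M.existsUnique_layer U hq ht
    obtain ⟨m, rfl⟩ : ∃ k, m = k + 1 := ⟨m - 1, by omega⟩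
    exact (hσ m q hm).1
  -- At a state of value zero every action is maximizing: the worst-case means all vanish at safe
  -- states, and at `qu` they coincide.
  · have hU0 : U q = 0 := by
      rw [hpos] at hq
      exact not_not.1 fun h => hq (pos_iff_ne_zero.2 h)
    refine ⟨σ.act_mem q, fun b hb => ?_⟩
    by_cases hqu : q = qu
    · subst hqu
      rw [worstExp, worstExp, habs b hb, habs _ (σ.act_mem q)]
    · refine (M.worstExp_le_bellmanValue ht hqu hb).trans ?_
      exact hU0.le.trans zero_le

end RobustMDP

end RobustReach

theorem mainTheorem2 {Q A : Type*} [Fintype Q] [Finite A]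
    [MeasurableSpace Q] [DiscreteMeasurableSpace Q]
    (M : RobustReach.RobustMDP Q A)
    -- the absorbing unsafe state; all other states are safe
    (qu : Q) (habs : ∀ a ∈ M.avail qu, M.Γ qu a = {PMF.pure qu})
    (tgt : Set Q) (htgt : tgt ⊆ {qu}ᶜ) :
    -- `m_max` exists
    (1 ≤ M.mMax {qu}ᶜ tgt ∧
      M.nested {qu}ᶜ tgt (M.mMax {qu}ᶜ tgt) = M.nested {qu}ᶜ tgt (M.mMax {qu}ᶜ tgt - 1)) ∧
    -- the construction covers exactly `Q_reach`, without ambiguity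
    M.nested {qu}ᶜ tgt (M.mMax {qu}ᶜ tgt) = M.reachSet {qu}ᶜ tgt ∧
    (∀ q ∈ M.reachSet {qu}ᶜ tgt \ tgt, ∃! m, 1 ≤ m ∧ m ≤ M.mMax {qu}ᶜ tgt ∧
      q ∈ M.nested {qu}ᶜ tgt m \ M.nested {qu}ᶜ tgt (m - 1)) ∧
    (∃ σ : M.StationaryStrategy, M.IsBackwardStrategy {qu}ᶜ tgt σ) ∧
    -- every strategy so constructed takes maximizing actions, is proper and is optimal
    ∀ σ : M.StationaryStrategy, M.IsBackwardStrategy {qu}ᶜ tgt σ →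
      (∀ q, σ.act q ∈
        (M.redirect tgt qu).argmaxActions (M.optReachProb {qu}ᶜ tgt) q) ∧
      M.IsProper tgt qu σ ∧
      M.IsOptimal {qu}ᶜ tgt σ.toStrategy := by
  have hV := M.optReachProb_eq_bellmanValue habs htgt
  obtain ⟨h1, hstab⟩ := M.mMax_spec {qu}ᶜ tgt
  have hreach : M.nested {qu}ᶜ tgt (M.mMax {qu}ᶜ tgt) = M.reachSet {qu}ᶜ tgt := by
    obtain ⟨k, hk⟩ : ∃ k, M.mMax {qu}ᶜ tgt = k + 1 := ⟨M.mMax {qu}ᶜ tgt - 1, by omega⟩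
    rw [hk] at hstab ⊢
    simp only [RobustReach.RobustMDP.nested_eq_backwardSets, hV, Nat.add_sub_cancel] at hstab ⊢
    rw [hstab, M.backwardSets_eq_pos habs htgt hstab, RobustReach.RobustMDP.reachSet, hV]
  refine ⟨⟨h1, hstab⟩, hreach, fun q hq => ?_, ?_, fun σ hσ => ?_⟩
  · rw [← hreach] at hq
    simp only [RobustReach.RobustMDP.nested_eq_backwardSets] at hq ⊢
    exact M.existsUnique_layer _ hq.1 hq.2
  · obtain ⟨σ, hσ⟩ := M.exists_makesProgress (M.optReachProb {qu}ᶜ tgt) tgt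
    exact ⟨σ, (M.isBackwardStrategy_iff_makesProgress _ _ σ).2 hσ⟩
  · rw [RobustReach.RobustMDP.isBackwardStrategy_iff_makesProgress] at hσ
    refine ⟨M.act_mem_argmaxActions_redirect habs htgt hσ,
      M.isProper_of_makesProgress habs htgt hσ, fun q σ' => ?_⟩
    rw [hV] at hσ
    refine le_trans ?_ (M.bellmanValue_le_worstReachProb habs htgt hσ q)
    rw [← hV]
    exact le_iSup (fun τ : M.Strategy => M.worstReachProb {qu}ᶜ tgt τ q) σ'
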